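/- Let $(x)_k=x(x+1)\cdots(x+k-1)$ denote the rising factorial. (i) The two series below converge, and $$\sum_{k=0}^{\infty}\frac{(\frac12)_k^2}{(1)_k^2}\,\frac1{2^k}\;\cdot\;\sum_{k=0}^{\infty}\frac{(\frac12)_k^2}{(1)_k^2}\,\frac{k}{2^k}=\frac1\pi .$$ (ii) For real $d,a,b$ put $A(d,a,b)=\sum_{k\ge0}\frac{(\frac12)_k^2}{(1)_k^2}d^{2k}\cdot\sum_{k\ge0}\frac{(\frac12)_k^2}{(1)_k^2}(a+bk)d^{2k}$. With the initial values $d_0=\frac1{\sqrt2}$, $a_0=0$, $b_0=1$, the left-hand side in (i) is $A(d_0,a_0,b_0)$, and the associated initial values $c_0=\frac{b_0}{1-d_0^2}$ and $r_0=a_0+c_0\,2^{-1}d_0^2$ are $c_0=2$ and $r_0=\frac12$. (iii) With these initial values, and with $s_0=\sqrt{d_0}$, $t_0=r_0=\frac12$, each of the following iterations converges to $\frac1\pi$. In the first three, $$d_{n+1}=\frac{1-\sqrt{1-d_n^2}}{1+\sqrt{1-d_n^2}}\qquad(n\ge0).$$ 1. $a_n\to\frac1\pi$, where $b_{n+1}=2b_n\frac{(1+d_{n+1})^3}{1-d_{n+1}}$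 and $a_{n+1}=a_n(1+d_{n+1})^2+\frac{b_{n+1}d_{n+1}}{2(1+d_{n+1})}$. 2. $a_n\to\frac1\pi$, where $a_{n+1}=a_n(1+d_{n+1})^2+c_0\,2^n d_{n+1}(1-d_{n+1})$. 3. $r_n\to\frac1\pi$, where $r_{n+1}=r_n(1+d_{n+1})^2-c_0\,2^n d_{n+1}$. 4. $t_n\to\frac1\pi$, where $s_{n+1}=\frac{1-\sqrt[4]{1-s_n^4}}{1+\sqrt[4]{1-s_n^4}}$ and $t_{n+1}=(1+s_{n+1})^4t_n-c_0\,2^{2n+1}s_{n+1}(1+s_{n+1}+s_{n+1}^2)$. -/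

import Mathlib

namespace BorweinPi

/-- The coefficient `(1/2)_k ^ 2 / (1)_k ^ 2`, where `(x)_k = x (x+1) ⋯ (x+k-1)`. -/
noncomputable def coeff (k : ℕ) : ℝ :=
  (ascPochhammer ℝ k).eval (1 / 2 : ℝ) ^ 2 / (ascPochhammer ℝ k).eval (1 : ℝ) ^ 2

/-- The product of two series attached to the parameters `d`, `a`, `b`:
`(∑ (1/2)_k²/(1)_k² d^(2k)) (∑ (1/2)_k²/(1)_k² (a + b k) d^(2k))`. -/
noncomputable def seriesProduct (d a b : ℝ) : ℝ :=
  (∑' k : ℕ, coeff k * d ^ (2 * k)) * (∑' k : ℕ, coeff k * (a + b * k) * d ^ (2 * k))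

/-- `c₀ = b₀ / (1 - d₀²)`. -/
noncomputable def initC (d₀ b₀ : ℝ) : ℝ := b₀ / (1 - d₀ ^ 2)

/-- `r₀`, determined by `a₀ = r₀ - c₀ 2^(0-1) d₀²`. -/
noncomputable def initR (d₀ a₀ c₀ : ℝ) : ℝ := a₀ + c₀ * (2 : ℝ) ^ (-1 : ℤ) * d₀ ^ 2

/-- `d_{n+1} = (1 - √(1 - d_n²)) / (1 + √(1 - d_n²))`. -/
noncomputable def dSeq (d₀ : ℝ) : ℕ → ℝ
  | 0 => d₀
  | n + 1 => (1 - √(1 - dSeq d₀ n ^ 2)) / (1 + √(1 - dSeq d₀ n ^ 2))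

/-- `b_{n+1} = 2 b_n (1 + d_{n+1})³ / (1 - d_{n+1})`. -/
noncomputable def bSeq (d₀ b₀ : ℝ) : ℕ → ℝ
  | 0 => b₀
  | n + 1 => 2 * bSeq d₀ b₀ n * ((1 + dSeq d₀ (n + 1)) ^ 3 / (1 - dSeq d₀ (n + 1)))

/-- The quadratic iteration
`a_{n+1} = a_n (1 + d_{n+1})² + b_{n+1} d_{n+1} / (2 (1 + d_{n+1}))`. -/
noncomputable def aSeq (d₀ a₀ b₀ : ℝ) : ℕ → ℝ
  | 0 => a₀
  | n + 1 => aSeq d₀ a₀ b₀ n * (1 + dSeq d₀ (n + 1)) ^ 2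
      + bSeq d₀ b₀ (n + 1) * dSeq d₀ (n + 1) / (2 * (1 + dSeq d₀ (n + 1)))

/-- The simplified iteration
`a_{n+1} = a_n (1 + d_{n+1})² + c₀ 2^n d_{n+1} (1 - d_{n+1})`. -/
noncomputable def aSimpleSeq (d₀ a₀ c₀ : ℝ) : ℕ → ℝ
  | 0 => a₀
  | n + 1 => aSimpleSeq d₀ a₀ c₀ n * (1 + dSeq d₀ (n + 1)) ^ 2
      + c₀ * 2 ^ n * dSeq d₀ (n + 1) * (1 - dSeq d₀ (n + 1))

/-- Borweins' quadratic iteration `r_{n+1} = r_n (1 + d_{n+1})² - c₀ 2^n d_{n+1}`. -/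
noncomputable def rSeq (d₀ c₀ r₀ : ℝ) : ℕ → ℝ
  | 0 => r₀
  | n + 1 => rSeq d₀ c₀ r₀ n * (1 + dSeq d₀ (n + 1)) ^ 2 - c₀ * 2 ^ n * dSeq d₀ (n + 1)

/-- `s_{n+1} = (1 - (1 - s_n⁴)^(1/4)) / (1 + (1 - s_n⁴)^(1/4))`. -/
noncomputable def sSeq (s₀ : ℝ) : ℕ → ℝ
  | 0 => s₀
  | n + 1 => (1 - (1 - sSeq s₀ n ^ 4) ^ (1 / 4 : ℝ)) / (1 + (1 - sSeq s₀ n ^ 4) ^ (1 / 4 : ℝ))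

/-- Borweins' quartic iteration
`t_{n+1} = (1 + s_{n+1})⁴ t_n - c₀ 2^(2n+1) s_{n+1} (1 + s_{n+1} + s_{n+1}²)`. -/
noncomputable def tSeq (s₀ c₀ t₀ : ℝ) : ℕ → ℝ
  | 0 => t₀
  | n + 1 => (1 + sSeq s₀ (n + 1)) ^ 4 * tSeq s₀ c₀ t₀ n
      - c₀ * 2 ^ (2 * n + 1) * sSeq s₀ (n + 1)
        * (1 + sSeq s₀ (n + 1) + sSeq s₀ (n + 1) ^ 2)

end BorweinPi

/-!
The series `f(x) = ∑ coeff k * x ^ k` is the hypergeometric function `₂F₁(1/2, 1/2; 1; x)`, that is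
`(2 / π) K(√x)` for the complete elliptic integral `K` of modulus `√x`. Everything follows from its
differential equation in self-adjoint form, `(x (1 - x) f')' = f / 4` (`hasDerivAt_ellP`), by two
Wronskian arguments.

* Both `f(x)` and `f(1 - x)` solve the equation, so `x (1 - x)` times their Wronskian is constant.
  Letting `x → 0`, an Abelian theorem and Wallis' formula, in the form `k * coeff k → 1 / π`, give the
  value `1 / π` (`ellF_mul_ellP_add`, which is Legendre's relation). At `x = 1 / 2` this is the
  product of the two series.
* Landen's transformation `f(4 y / (1 + y)²) = (1 + y) f(y²)` (`ellF_landen`) holds because both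
  sides solve one self-adjoint equation with a singular point at `0`, both are regular there, and
  both have the value `1` there. The map
  `d_n ↦ d_{n+1} = y` inverts `d² = 4 y / (1 + y)²`, so the transformation and its derivative say that
  `f(x) (a f(x) + b x f'(x))`, at `x = d²`, is unchanged by one step of the iteration of `d, a, b`
  (`ellF_mul_invariant`).

Since `d_n → 0` faster than `2 ^ n` grows, the invariant tends to `lim a_n`, while initially it is
the product of series, `1 / π`. The remaining iterations are the same one in other variables:
`b_n = c₀ 2ⁿ (1 - d_n²)` eliminates `b`, `r_n = a_n + c₀ 2ⁿ⁻¹ d_n²` is a vanishing perturbation of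
`a_n`, and the quartic iteration is every second step of the quadratic one, with `d_{2n} = s_n²` and
`t_n = r_{2n}`.
-/

open Filter Topology Set

namespace BorweinPi

/-! ### Power series with polynomially bounded coefficients -/

lemma summable_mul_pow_of_le {u : ℕ → ℝ} {p : ℕ} (hu : ∀ k, |u k| ≤ ((k : ℝ) + 1) ^ p) {x : ℝ}
    (hx : |x| < 1) : Summable fun k => u k * x ^ k := by
  have h1 : Summable fun k : ℕ => ((k : ℝ) + 1) ^ p * |x| ^ k := by
    have h2 : Summable fun k : ℕ => 2 ^ p * ((k : ℝ) ^ p * |x| ^ k) :=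
      (summable_pow_mul_geometric_of_norm_lt_one p (r := |x|) (by simpa using hx)).mul_left _
    refine Summable.of_norm_bounded_eventually_nat h2 ?_
    filter_upwards [eventually_ge_atTop 1] with k hk
    have hk' : (1 : ℝ) ≤ k := by exact_mod_cast hk
    rw [Real.norm_of_nonneg (by positivity), ← mul_assoc, ← mul_pow]
    gcongr
    linarith
  refine Summable.of_norm_bounded h1 fun k => ?_
  rw [norm_mul, norm_pow, Real.norm_eq_abs, Real.norm_eq_abs]
  exact mul_le_mul_of_nonneg_right (hu k) (by positivity)

/-- The coefficients of the derived series are again polynomially bounded, after a rescaling that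
keeps the bound in the form `(k + 1) ^ p`. -/
lemma abs_shift_le {u : ℕ → ℝ} {p : ℕ} (hu : ∀ k, |u k| ≤ ((k : ℝ) + 1) ^ p) (k : ℕ) :
    |((k : ℝ) + 1) * u (k + 1) / 2 ^ (p + 1)| ≤ ((k : ℝ) + 1) ^ (p + 1) := by
  have h := hu (k + 1)
  push_cast at h
  rw [abs_div, abs_mul, abs_of_nonneg (by positivity : (0 : ℝ) ≤ (k : ℝ) + 1),
    abs_of_nonneg (by positivity : (0 : ℝ) ≤ (2 : ℝ) ^ (p + 1)), div_le_iff₀ (by positivity)]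
  calc ((k : ℝ) + 1) * |u (k + 1)| ≤ ((k : ℝ) + 1) * (((k : ℝ) + 1) * 2) ^ p := by
        gcongr
        refine h.trans ?_
        gcongr
        linarith [(Nat.cast_nonneg k : (0 : ℝ) ≤ k)]
    _ ≤ ((k : ℝ) + 1) ^ (p + 1) * 2 ^ (p + 1) := by
        rw [mul_pow, pow_succ, pow_succ]
        nlinarith [mul_nonneg (pow_nonneg (by positivity : (0 : ℝ) ≤ (k : ℝ) + 1) p)
          (by positivity : (0 : ℝ) ≤ ((k : ℝ) + 1) * 2 ^ p)]

lemma summable_deriv_mul_pow_of_le {u : ℕ → ℝ} {p : ℕ} (hu : ∀ k, |u k| ≤ ((k : ℝ) + 1) ^ p)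
    {x : ℝ} (hx : |x| < 1) : Summable fun k : ℕ => ((k : ℝ) + 1) * u (k + 1) * x ^ k := by
  refine ((summable_mul_pow_of_le (abs_shift_le hu) hx).mul_left (2 ^ (p + 1))).congr fun k => ?_
  field_simp

/-- Termwise differentiation of a power series with polynomially bounded coefficients. -/
lemma hasDerivAt_tsum_mul_pow {u : ℕ → ℝ} {p : ℕ} (hu : ∀ k, |u k| ≤ ((k : ℝ) + 1) ^ p) {x : ℝ}
    (hx : |x| < 1) :
    HasDerivAt (fun y : ℝ => ∑' k, u k * y ^ k) (∑' k : ℕ, ((k : ℝ) + 1) * u (k + 1) * x ^ k) x := by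
  obtain ⟨r, hxr, hr⟩ := exists_between hx
  have hr0 : 0 ≤ r := (abs_nonneg x).trans hxr.le
  have hs : Summable fun k : ℕ => |(k : ℝ) * u k * r ^ (k - 1)| := by
    rw [← summable_nat_add_iff 1]
    refine (summable_deriv_mul_pow_of_le hu (x := r) (by rwa [abs_of_nonneg hr0])).abs.congr
      fun k => ?_
    simp
  have key := hasDerivAt_tsum_of_isPreconnected (𝕜 := ℝ) hs (t := Ioo (-r) r) isOpen_Ioo
    isPreconnected_Ioo (g := fun k y => u k * y ^ k)
    (g' := fun k y => (k : ℝ) * u k * y ^ (k - 1)) (y₀ := x) (y := x)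
    (fun k y _ => ((hasDerivAt_pow k y).const_mul (u k)).congr_deriv (by ring))
    (fun k y hy => by
      rw [Real.norm_eq_abs, abs_mul, abs_mul, abs_mul, abs_mul, abs_pow, abs_pow,
        abs_of_nonneg hr0]
      gcongr
      exact (abs_lt.mpr hy).le)
    (abs_lt.mp hxr) (summable_mul_pow_of_le hu hx) (abs_lt.mp hxr)
  refine key.congr_deriv ?_
  have h0 : Summable fun k : ℕ => (k : ℝ) * u k * x ^ (k - 1) := by
    rw [← summable_nat_add_iff 1]
    refine (summable_deriv_mul_pow_of_le hu hx).congr fun k => ?_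
    simp
  rw [h0.tsum_eq_zero_add]
  simp

/-- Abelian theorem for Abel means: if `u k → l` then `(1 - x) ∑ u k x ^ k → l` as `x → 1⁻`. -/
lemma tendsto_one_sub_mul_tsum {u : ℕ → ℝ} {p : ℕ} (hu : ∀ k, |u k| ≤ ((k : ℝ) + 1) ^ p) {l : ℝ}
    (hl : Tendsto u atTop (𝓝 l)) :
    Tendsto (fun x : ℝ => (1 - x) * ∑' k, u k * x ^ k) (𝓝[<] 1) (𝓝 l) := by
  -- `(1 - x) ∑ u k x ^ k` is the power series whose partial sums at `1` are the `u k`.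
  obtain ⟨v, hv0, hvs⟩ : ∃ v : ℕ → ℝ, v 0 = u 0 ∧ ∀ k, v (k + 1) = u (k + 1) - u k :=
    ⟨fun k => Nat.casesOn k (u 0) fun k => u (k + 1) - u k, rfl, fun _ => rfl⟩
  have hv : ∀ n, ∑ i ∈ Finset.range (n + 1), v i = u n := by
    intro n
    induction n with
    | zero => simp [hv0]
    | succ n ih => rw [Finset.sum_range_succ, ih, hvs]; ring
  have h1 : Tendsto (fun n => ∑ i ∈ Finset.range n, v i) atTop (𝓝 l) := by
    rw [← tendsto_add_atTop_iff_nat 1]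
    exact hl.congr fun n => (hv n).symm
  refine (Real.tendsto_tsum_powerSeries_nhdsWithin_lt h1).congr' ?_
  filter_upwards [Ioo_mem_nhdsLT (show (-1 : ℝ) < 1 by norm_num)] with x hx
  have hs := summable_mul_pow_of_le hu (abs_lt.mpr hx)
  have hs1 : Summable fun k => u (k + 1) * x ^ (k + 1) :=
    (summable_nat_add_iff (f := fun k => u k * x ^ k) 1).mpr hs
  have e1 : HasSum (fun k => v (k + 1) * x ^ (k + 1))
      (∑' k, u (k + 1) * x ^ (k + 1) - x * ∑' k, u k * x ^ k) := by
    refine (hs1.hasSum.sub (hs.hasSum.mul_left x)).congr_fun fun k => ?_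
    rw [hvs]
    ring
  have hsv : Summable fun k => v k * x ^ k :=
    (summable_nat_add_iff (f := fun k => v k * x ^ k) 1).mp e1.summable
  rw [hsv.tsum_eq_zero_add, e1.tsum_eq, hv0, sub_mul, one_mul]
  rw [hs.tsum_eq_zero_add]
  ring

/-! ### The coefficients -/

lemma coeff_zero : coeff 0 = 1 := by simp [coeff]

lemma coeff_succ (k : ℕ) : coeff (k + 1) = coeff k * ((2 * k + 1) / (2 * k + 2)) ^ 2 := by
  have h : (ascPochhammer ℝ k).eval (1 : ℝ) ≠ 0 := (ascPochhammer_pos k 1 one_pos).ne'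
  have h' : (1 : ℝ) + k ≠ 0 := by positivity
  unfold coeff
  rw [ascPochhammer_succ_eval, ascPochhammer_succ_eval]
  field_simp
  ring

lemma coeff_pos (k : ℕ) : 0 < coeff k := by
  induction k with
  | zero => simp [coeff_zero]
  | succ k ih => rw [coeff_succ]; positivity

/-- The numbers `(2 k + 1) * coeff k` are the reciprocals of Wallis' products. -/
lemma coeff_mul_wallis (k : ℕ) : coeff k * (2 * k + 1) * Real.Wallis.W k = 1 := by
  induction k with
  | zero => simp [coeff_zero, Real.Wallis.W]
  | succ k ih =>
    rw [coeff_succ, Real.Wallis.W_succ]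
    refine Eq.trans ?_ ih
    push_cast
    field_simp
    ring

lemma coeff_le_one (k : ℕ) : coeff k ≤ 1 := by
  induction k with
  | zero => simp [coeff_zero]
  | succ k ih =>
    rw [coeff_succ]
    refine mul_le_one₀ ih (by positivity) (pow_le_one₀ (by positivity) ?_)
    rw [div_le_one (by positivity)]
    linarith

lemma abs_coeff_le (k : ℕ) : |coeff k| ≤ ((k : ℝ) + 1) ^ 0 := by
  rw [abs_of_pos (coeff_pos k), pow_zero]
  exact coeff_le_one k

/-- Wallis' formula, as the asymptotics `k * coeff k → 1 / π`. -/
lemma tendsto_succ_mul_coeff_succ :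
    Tendsto (fun k : ℕ => ((k : ℝ) + 1) * coeff (k + 1)) atTop (𝓝 (1 / Real.pi)) := by
  have h1 : Tendsto (fun k : ℕ => (2 * Real.Wallis.W k)⁻¹) atTop (𝓝 (1 / Real.pi)) := by
    have h := (Real.Wallis.tendsto_W_nhds_pi_div_two.const_mul 2).inv₀
      (by have := Real.pi_pos; positivity)
    convert h using 2
    field_simp
  -- `(k + 1) c_{k+1} = (2 k + 1) / (2 k + 2) · (2 k + 1) c_k / 2`
  have h2 : Tendsto (fun k : ℕ => 1 - (1 / 2 : ℝ) * (1 / ((k : ℝ) + 1))) atTop (𝓝 1) := by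
    simpa using (tendsto_one_div_add_atTop_nhds_zero_nat (𝕜 := ℝ)).const_mul (1 / 2 : ℝ)
      |>.const_sub 1
  have h3 := h1.mul h2
  rw [mul_one] at h3
  refine h3.congr fun k => ?_
  have hW := Real.Wallis.W_pos k
  have hc := coeff_mul_wallis k
  have : coeff k = 1 / ((2 * k + 1) * Real.Wallis.W k) := by
    field_simp
    linarith
  rw [coeff_succ, this]
  field_simp
  ring

lemma tendsto_coeff : Tendsto coeff atTop (𝓝 0) := by
  rw [← tendsto_add_atTop_iff_nat 1]
  have h := tendsto_succ_mul_coeff_succ.mul (tendsto_one_div_add_atTop_nhds_zero_nat (𝕜 := ℝ))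
  rw [mul_zero] at h
  refine h.congr fun k => ?_
  field_simp

/-! ### The hypergeometric function and its differential equation -/

/-- The hypergeometric function `₂F₁(1/2, 1/2; 1; x) = ∑ coeff k * x ^ k`, which is
`(2 / π) K(√x)` for the complete elliptic integral `K`. -/
noncomputable def ellF (x : ℝ) : ℝ := ∑' k, coeff k * x ^ k

/-- The derivative of `ellF`, as a power series. -/
noncomputable def ellF' (x : ℝ) : ℝ := ∑' k : ℕ, ((k : ℝ) + 1) * coeff (k + 1) * x ^ k

/-- The flux `x (1 - x) ellF'(x)` of the hypergeometric equation in its self-adjoint form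
`(x (1 - x) ellF')' = ellF / 4`. -/
noncomputable def ellP (x : ℝ) : ℝ := x * (1 - x) * ellF' x

lemma succ_mul_coeff_succ_le (k : ℕ) : ((k : ℝ) + 1) * coeff (k + 1) ≤ (k : ℝ) + 1 :=
  mul_le_of_le_one_right (by positivity) (coeff_le_one _)

lemma abs_succ_mul_coeff_succ_le (k : ℕ) :
    |((k : ℝ) + 1) * coeff (k + 1)| ≤ ((k : ℝ) + 1) ^ 1 := by
  have := coeff_pos (k + 1)
  rw [abs_of_pos (by positivity), pow_one]
  exact succ_mul_coeff_succ_le k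

lemma hasDerivAt_ellF {x : ℝ} (hx : |x| < 1) : HasDerivAt ellF (ellF' x) x :=
  hasDerivAt_tsum_mul_pow abs_coeff_le hx

lemma continuousAt_ellF' {x : ℝ} (hx : |x| < 1) : ContinuousAt ellF' x :=
  (hasDerivAt_tsum_mul_pow abs_succ_mul_coeff_succ_le hx).continuousAt

/-- The hypergeometric equation: the coefficient of `x ^ k` in `(x (1 - x) ellF')'` is
`(k + 1)² c_{k+1} - k (k + 1) c_k = c_k / 4`. -/
lemma hasDerivAt_ellP {x : ℝ} (hx : |x| < 1) : HasDerivAt ellP (ellF x / 4) x := by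
  have hd := hasDerivAt_tsum_mul_pow abs_succ_mul_coeff_succ_le hx
  have hp : HasDerivAt (fun y : ℝ => y * (1 - y)) (1 - 2 * x) x := by
    refine ((hasDerivAt_id x).mul ((hasDerivAt_id x).const_sub 1)).congr_deriv ?_
    simp only [id]
    ring
  refine (hp.mul hd).congr_deriv ?_
  have s0 := (summable_mul_pow_of_le abs_coeff_le hx).hasSum
  have s1 := (summable_mul_pow_of_le abs_succ_mul_coeff_succ_le hx).hasSum
  have s2 := (summable_deriv_mul_pow_of_le abs_succ_mul_coeff_succ_le hx).hasSum
  set F := ∑' k, coeff k * x ^ k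
  set F1 := ∑' k : ℕ, ((k : ℝ) + 1) * coeff (k + 1) * x ^ k
  set F2 := ∑' k : ℕ, ((k : ℝ) + 1) * (((k + 1 : ℕ) : ℝ) + 1) * coeff (k + 1 + 1) * x ^ k
  have s2' : HasSum (fun k : ℕ => ((k : ℝ) + 1) * (((k + 1 : ℕ) : ℝ) + 1) * coeff (k + 1 + 1) * x ^ k)
      F2 := (s2.summable.congr fun k => by ring).hasSum
  -- `x F1`, `x F2` and `x² F2` as power series
  have a1 : HasSum (fun k : ℕ => (k : ℝ) * coeff k * x ^ k) (x * F1) := by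
    rw [← hasSum_nat_add_iff' 1]
    simp only [Finset.sum_range_one, Nat.cast_zero, zero_mul, sub_zero]
    refine (s1.mul_left x).congr_fun fun k => ?_
    push_cast
    ring
  have a2 : HasSum (fun k : ℕ => (k : ℝ) * ((k : ℝ) + 1) * coeff (k + 1) * x ^ k) (x * F2) := by
    rw [← hasSum_nat_add_iff' 1]
    simp only [Finset.sum_range_one, Nat.cast_zero, zero_mul, sub_zero]
    refine (s2'.mul_left x).congr_fun fun k => ?_
    push_cast
    ring
  have a3 : HasSum (fun k : ℕ => (k : ℝ) * ((k : ℝ) - 1) * coeff k * x ^ k) (x * (x * F2)) := by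
    rw [← hasSum_nat_add_iff' 1]
    simp only [Finset.sum_range_one, Nat.cast_zero, zero_mul, sub_zero]
    refine (a2.mul_left x).congr_fun fun k => ?_
    push_cast
    ring
  have key := ((a2.sub a3).add (s1.sub (a1.mul_left 2))).unique
    ((s0.div_const 4).congr_fun fun k => by
      rw [coeff_succ]
      field_simp
      ring)
  have e2 : ∑' k : ℕ, ((k : ℝ) + 1) * ((((k + 1 : ℕ) : ℝ) + 1) * coeff (k + 1 + 1)) * x ^ k = F2 :=
    tsum_congr fun k => by ring
  rw [e2]
  change _ = F / 4
  rw [← key]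
  ring

lemma ellF_zero : ellF 0 = 1 := by
  unfold ellF
  rw [tsum_eq_single 0 (fun k hk => by simp [hk])]
  simp [coeff_zero]

lemma ellP_zero : ellP 0 = 0 := by simp [ellP]

lemma ellF_pos {x : ℝ} (h0 : 0 ≤ x) (h1 : x < 1) : 0 < ellF x := by
  have hs := summable_mul_pow_of_le abs_coeff_le (x := x) (by rwa [abs_of_nonneg h0])
  exact hs.tsum_pos (fun k => mul_nonneg (coeff_pos k).le (pow_nonneg h0 k)) 0 (by simp [coeff_zero])

lemma tendsto_one_sub_mul_ellF : Tendsto (fun x => (1 - x) * ellF x) (𝓝[<] 1) (𝓝 0) :=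
  tendsto_one_sub_mul_tsum abs_coeff_le tendsto_coeff

lemma tendsto_ellP : Tendsto ellP (𝓝[<] 1) (𝓝 (1 / Real.pi)) := by
  have h := tendsto_one_sub_mul_tsum abs_succ_mul_coeff_succ_le tendsto_succ_mul_coeff_succ
  have hx : Tendsto (fun x : ℝ => x) (𝓝[<] 1) (𝓝 1) := tendsto_id.mono_left nhdsWithin_le_nhds
  have := hx.mul h
  rw [one_mul] at this
  exact this.congr fun x => by simp only [ellP, ellF']; ring

/-! ### Legendre's relation -/

/-- No differentiability is needed at the end points, where the equations considered below are
singular. -/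
lemma eq_of_hasDerivAt_zero {g : ℝ → ℝ} {a b : ℝ} (hab : a < b) (hc : ContinuousOn g (Icc a b))
    (hg : ∀ x ∈ Ioo a b, HasDerivAt g 0 x) : g b = g a := by
  obtain ⟨c, -, h⟩ := exists_hasDerivAt_eq_slope g (fun _ => 0) hab hc hg
  have : b - a ≠ 0 := (sub_pos.mpr hab).ne'
  field_simp at h
  linarith

/-- Legendre's relation: the Wronskian of the two solutions `ellF x` and `ellF (1 - x)` of the
hypergeometric equation is constant, and its value is found by letting `x → 0`. -/
lemma ellF_mul_ellP_add {x : ℝ} (h0 : 0 < x) (h1 : x < 1) :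
    ellF x * ellP (1 - x) + ellP x * ellF (1 - x) = 1 / Real.pi := by
  set w : ℝ → ℝ := fun x => ellF x * ellP (1 - x) + ellP x * ellF (1 - x) with hw
  have hd : ∀ y ∈ Ioo (0 : ℝ) 1, HasDerivAt w 0 y := by
    rintro y ⟨hy0, hy1⟩
    have hy : |y| < 1 := abs_lt.mpr ⟨by linarith, hy1⟩
    have hy' : |1 - y| < 1 := abs_lt.mpr ⟨by linarith, by linarith⟩
    have hs : HasDerivAt (fun y : ℝ => 1 - y) (-1) y := (hasDerivAt_id y).const_sub 1
    have e1 := (hasDerivAt_ellF hy).mul ((hasDerivAt_ellP hy').comp y hs)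
    have e2 := (hasDerivAt_ellP hy).mul ((hasDerivAt_ellF hy').comp y hs)
    refine (e1.add e2).congr_deriv ?_
    simp only [ellP, Function.comp]
    ring
  have hconst : ∀ y ∈ Ioo (0 : ℝ) x, w y = w x := by
    rintro y ⟨hy0, hyx⟩
    refine (eq_of_hasDerivAt_zero hyx (fun z hz => ?_) fun z hz => ?_).symm
    · exact (hd z ⟨by linarith [hz.1], by linarith [hz.2]⟩).continuousAt.continuousWithinAt
    · exact hd z ⟨by linarith [hz.1], by linarith [hz.2]⟩
  have hsub : Tendsto (fun y : ℝ => 1 - y) (𝓝[>] 0) (𝓝[<] 1) := by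
    refine tendsto_nhdsWithin_of_tendsto_nhds_of_eventually_within _ ?_ ?_
    · have : Tendsto (fun y : ℝ => 1 - y) (𝓝 0) (𝓝 (1 - 0)) :=
        (continuous_const.sub continuous_id).tendsto 0
      rw [sub_zero] at this
      exact this.mono_left nhdsWithin_le_nhds
    · filter_upwards [self_mem_nhdsWithin] with y hy
      simpa using hy
  have hF : Tendsto ellF (𝓝[>] 0) (𝓝 1) := by
    rw [← ellF_zero]
    exact (hasDerivAt_ellF (by simp)).continuousAt.tendsto.mono_left nhdsWithin_le_nhds
  have hF' : Tendsto (fun y => (1 - y) * ellF' y) (𝓝[>] 0) (𝓝 ((1 - 0) * ellF' 0)) :=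
    (((continuous_const.sub continuous_id).continuousAt).mul
      (continuousAt_ellF' (by simp))).tendsto.mono_left nhdsWithin_le_nhds
  -- the logarithmic singularity of `ellF` at `1` is absorbed by the factor `x` of `ellP x`
  have hlim := (hF.mul (tendsto_ellP.comp hsub)).add
    (hF'.mul (tendsto_one_sub_mul_ellF.comp hsub))
  rw [one_mul, mul_zero, add_zero] at hlim
  refine tendsto_nhds_unique (tendsto_const_nhds.congr' ?_) hlim
  filter_upwards [Ioo_mem_nhdsGT h0] with y hy
  refine (hconst y hy).symm.trans ?_
  simp only [hw, ellP, Function.comp]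
  ring

/-! ### The quadratic transformation -/

lemma abs_landen_lt_one {z : ℝ} (hz : z ∈ Ico (0 : ℝ) 1) : |4 * z / (1 + z) ^ 2| < 1 := by
  obtain ⟨hz0, hz1⟩ := hz
  rw [abs_of_nonneg (by positivity), div_lt_one (by positivity)]
  nlinarith [mul_pos (sub_pos.mpr hz1) (sub_pos.mpr hz1)]

lemma abs_sq_lt_one {z : ℝ} (hz : z ∈ Ico (0 : ℝ) 1) : |z ^ 2| < 1 := by
  rw [abs_of_nonneg (sq_nonneg z)]
  exact pow_lt_one₀ hz.1 hz.2 two_ne_zero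

lemma hasDerivAt_landen {z : ℝ} (hz : z ∈ Ico (0 : ℝ) 1) :
    HasDerivAt (fun z : ℝ => 4 * z / (1 + z) ^ 2) (4 * (1 - z) / (1 + z) ^ 3) z := by
  obtain ⟨hz0, hz1⟩ := hz
  have hz : 1 + z ≠ 0 := by positivity
  have := ((hasDerivAt_id z).const_mul 4).div (((hasDerivAt_id z).const_add 1).pow 2)
    (pow_ne_zero 2 hz)
  refine this.congr_deriv ?_
  simp only [id, Pi.pow_apply]
  field_simp
  ring

lemma hasDerivAt_ellF_landen {z : ℝ} (hz : z ∈ Ico (0 : ℝ) 1) :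
    HasDerivAt (fun z : ℝ => ellF (4 * z / (1 + z) ^ 2))
      (ellF' (4 * z / (1 + z) ^ 2) * (4 * (1 - z) / (1 + z) ^ 3)) z :=
  (hasDerivAt_ellF (abs_landen_lt_one hz)).comp (h := fun z : ℝ => 4 * z / (1 + z) ^ 2) z
    (hasDerivAt_landen hz)

lemma hasDerivAt_ellF_sq {z : ℝ} (hz : z ∈ Ico (0 : ℝ) 1) :
    HasDerivAt (fun z : ℝ => ellF (z ^ 2)) (ellF' (z ^ 2) * (2 * z)) z :=
  (hasDerivAt_ellF (abs_sq_lt_one hz)).comp (h := fun z : ℝ => z ^ 2) z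
    ((hasDerivAt_pow 2 z).congr_deriv (by ring))

lemma hasDerivAt_one_add_mul_ellF_sq {z : ℝ} (hz : z ∈ Ico (0 : ℝ) 1) :
    HasDerivAt (fun z : ℝ => (1 + z) * ellF (z ^ 2))
      (ellF (z ^ 2) + (1 + z) * (ellF' (z ^ 2) * (2 * z))) z := by
  refine (((hasDerivAt_id z).const_add 1).mul (hasDerivAt_ellF_sq hz)).congr_deriv ?_
  simp only [id]
  ring

/-- Landen's transformation. With `X = 4 y / (1 + y)²`, both sides solve the self-adjoint equation
`(p w')' = q w` with `p = y (1 - y) / (1 + y)` and `q = (1 - y) / (1 + y)³`. As `p` vanishes at `0`,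
so does their Wronskian, and the sides are proportional. -/
lemma ellF_landen {y : ℝ} (h0 : 0 < y) (h1 : y < 1) :
    ellF (4 * y / (1 + y) ^ 2) = (1 + y) * ellF (y ^ 2) := by
  set u : ℝ → ℝ := fun y => ellF (4 * y / (1 + y) ^ 2) with hu
  set v : ℝ → ℝ := fun y => (1 + y) * ellF (y ^ 2) with hv
  -- `U` and `V` are the fluxes `p u'` and `p v'`
  set U : ℝ → ℝ := fun y => ellP (4 * y / (1 + y) ^ 2) with hU
  set V : ℝ → ℝ := fun y => y * (1 - y) / (1 + y) * ellF (y ^ 2) + 2 / (1 + y) * ellP (y ^ 2) with hV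
  have du : ∀ z ∈ Ico (0 : ℝ) 1,
      HasDerivAt u (ellF' (4 * z / (1 + z) ^ 2) * (4 * (1 - z) / (1 + z) ^ 3)) z := fun z hz =>
    hasDerivAt_ellF_landen hz
  have dv : ∀ z ∈ Ico (0 : ℝ) 1,
      HasDerivAt v (ellF (z ^ 2) + (1 + z) * (ellF' (z ^ 2) * (2 * z))) z := fun z hz =>
    hasDerivAt_one_add_mul_ellF_sq hz
  have dU : ∀ z ∈ Ico (0 : ℝ) 1, HasDerivAt U ((1 - z) / (1 + z) ^ 3 * u z) z := by
    intro z hz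
    refine ((hasDerivAt_ellP (abs_landen_lt_one hz)).comp z (hasDerivAt_landen hz)).congr_deriv ?_
    simp only [hu]
    ring
  have dP : ∀ z ∈ Ico (0 : ℝ) 1, HasDerivAt (fun z => ellP (z ^ 2)) (ellF (z ^ 2) / 4 * (2 * z)) z :=
    fun z hz => (hasDerivAt_ellP (abs_sq_lt_one hz)).comp (h := fun z : ℝ => z ^ 2) z
      ((hasDerivAt_pow 2 z).congr_deriv (by ring))
  have dV : ∀ z ∈ Ico (0 : ℝ) 1, HasDerivAt V ((1 - z) / (1 + z) ^ 3 * v z) z := by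
    rintro z ⟨hz0, hz1⟩
    have hz : 1 + z ≠ 0 := by positivity
    have d1 := (((hasDerivAt_id z).mul ((hasDerivAt_id z).const_sub 1)).div
      ((hasDerivAt_id z).const_add 1) hz).mul (hasDerivAt_ellF_sq ⟨hz0, hz1⟩)
    have d2 := (((hasDerivAt_const z (2 : ℝ)).div ((hasDerivAt_id z).const_add 1) hz)).mul
      (dP z ⟨hz0, hz1⟩)
    refine (d1.add d2).congr_deriv ?_
    simp only [hv, id, ellP, Pi.mul_apply, Pi.div_apply]
    field_simp
    ring
  have hUp : ∀ z ∈ Ioo (0 : ℝ) 1, ellF' (4 * z / (1 + z) ^ 2) * (4 * (1 - z) / (1 + z) ^ 3)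
      = U z * ((1 + z) / (z * (1 - z))) := by
    rintro z ⟨hz0, hz1⟩
    have : 1 - z ≠ 0 := by linarith
    simp only [hU, ellP]
    field_simp
    ring
  have hVp : ∀ z ∈ Ioo (0 : ℝ) 1, ellF (z ^ 2) + (1 + z) * (ellF' (z ^ 2) * (2 * z))
      = V z * ((1 + z) / (z * (1 - z))) := by
    rintro z ⟨hz0, hz1⟩
    have : 1 - z ≠ 0 := by linarith
    simp only [hV, ellP]
    field_simp
    ring
  have hU0 : U 0 = 0 := by simp [hU, ellP_zero]
  have hV0 : V 0 = 0 := by simp [hV, ellP_zero]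
  have hwron : ∀ z ∈ Ioo (0 : ℝ) 1, u z * V z = v z * U z := by
    rintro z ⟨hz0, hz1⟩
    have hI : ∀ t ∈ Icc 0 z, t ∈ Ico (0 : ℝ) 1 := fun t ht => ⟨ht.1, ht.2.trans_lt hz1⟩
    have := eq_of_hasDerivAt_zero (g := fun t => u t * V t - v t * U t) hz0
      (fun t ht => (((du t (hI t ht)).mul (dV t (hI t ht))).sub
        ((dv t (hI t ht)).mul (dU t (hI t ht)))).continuousAt.continuousWithinAt)
      (fun t ht => by
        have ht' : t ∈ Ioo (0 : ℝ) 1 := ⟨ht.1, ht.2.trans hz1⟩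
        have ht'' : t ∈ Ico (0 : ℝ) 1 := ⟨ht.1.le, ht.2.trans hz1⟩
        refine (((du t ht'').mul (dV t ht'')).sub
          ((dv t ht'').mul (dU t ht''))).congr_deriv ?_
        rw [hUp t ht', hVp t ht']
        ring)
    simp only [hU0, hV0] at this
    linarith
  have hvpos : ∀ z ∈ Ico (0 : ℝ) 1, v z ≠ 0 := fun z hz =>
    (mul_pos (by linarith [hz.1]) (ellF_pos (sq_nonneg z) (abs_lt.mp (abs_sq_lt_one hz)).2)).ne'
  have hI : ∀ t ∈ Icc 0 y, t ∈ Ico (0 : ℝ) 1 := fun t ht => ⟨ht.1, ht.2.trans_lt h1⟩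
  have hquot := eq_of_hasDerivAt_zero (g := fun t => u t / v t) h0
    (fun t ht => ((du t (hI t ht)).div (dv t (hI t ht))
      (hvpos t (hI t ht))).continuousAt.continuousWithinAt)
    (fun t ht => by
      have ht' : t ∈ Ioo (0 : ℝ) 1 := ⟨ht.1, ht.2.trans h1⟩
      have ht'' : t ∈ Ico (0 : ℝ) 1 := ⟨ht.1.le, ht.2.trans h1⟩
      refine ((du t ht'').div (dv t ht'') (hvpos t ht'')).congr_deriv ?_
      rw [hUp t ht', hVp t ht', div_eq_zero_iff]
      left
      linear_combination (-((1 + t) / (t * (1 - t)))) * hwron t ht')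
  have hu0 : u 0 = 1 := by simp [hu, ellF_zero]
  have hv0 : v 0 = 1 := by simp [hv, ellF_zero]
  simp only [hu0, hv0, div_one] at hquot
  exact (div_eq_one_iff_eq (hvpos y ⟨h0.le, h1⟩)).mp hquot

/-- The derivative of Landen's transformation. -/
lemma ellF'_landen {y : ℝ} (h0 : 0 < y) (h1 : y < 1) :
    ellF' (4 * y / (1 + y) ^ 2) * (4 * (1 - y) / (1 + y) ^ 3) =
      ellF (y ^ 2) + 2 * y * (1 + y) * ellF' (y ^ 2) := by
  have d1 := hasDerivAt_ellF_landen ⟨h0.le, h1⟩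
  have d2 := hasDerivAt_one_add_mul_ellF_sq ⟨h0.le, h1⟩
  have he : (fun z : ℝ => (1 + z) * ellF (z ^ 2)) =ᶠ[𝓝 y] fun z => ellF (4 * z / (1 + z) ^ 2) := by
    filter_upwards [Ioo_mem_nhds h0 h1] with z hz
    exact (ellF_landen hz.1 hz.2).symm
  rw [d1.unique (d2.congr_of_eventuallyEq he.symm)]
  ring

/-! ### The moduli -/

lemma dSeq_succ_spec {d₀ : ℝ} {n : ℕ} (h0 : 0 < dSeq d₀ n) (h1 : dSeq d₀ n < 1) :
    0 < dSeq d₀ (n + 1) ∧ dSeq d₀ (n + 1) < 1 ∧ dSeq d₀ (n + 1) ≤ dSeq d₀ n ^ 2 ∧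
      dSeq d₀ n ^ 2 = 4 * dSeq d₀ (n + 1) / (1 + dSeq d₀ (n + 1)) ^ 2 := by
  have hd : 0 < 1 - dSeq d₀ n ^ 2 := by nlinarith
  have hq : 0 < √(1 - dSeq d₀ n ^ 2) := Real.sqrt_pos.mpr hd
  have hq2 : √(1 - dSeq d₀ n ^ 2) ^ 2 = 1 - dSeq d₀ n ^ 2 := Real.sq_sqrt hd.le
  simp only [dSeq]
  set q := √(1 - dSeq d₀ n ^ 2)
  have hd2 : dSeq d₀ n ^ 2 = 1 - q ^ 2 := by linarith
  have hq1 : q < 1 := by nlinarith [pow_pos h0 2]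
  rw [hd2]
  refine ⟨div_pos (by linarith) (by linarith), ?_, ?_, ?_⟩
  · rw [div_lt_one (by linarith)]
    linarith
  · rw [div_le_iff₀ (by linarith)]
    nlinarith [mul_pos hq (sub_pos.mpr hq1), mul_pos (mul_pos hq hq) (sub_pos.mpr hq1)]
  · field_simp
    ring

lemma dSeq_mem_Ioo {d₀ : ℝ} (h : d₀ ∈ Ioo (0 : ℝ) 1) (n : ℕ) : dSeq d₀ n ∈ Ioo (0 : ℝ) 1 := by
  induction n with
  | zero => exact h
  | succ n ih => exact ⟨(dSeq_succ_spec ih.1 ih.2).1, (dSeq_succ_spec ih.1 ih.2).2.1⟩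

lemma dSeq_succ_le_sq {d₀ : ℝ} (h : d₀ ∈ Ioo (0 : ℝ) 1) (n : ℕ) :
    dSeq d₀ (n + 1) ≤ dSeq d₀ n ^ 2 :=
  (dSeq_succ_spec (dSeq_mem_Ioo h n).1 (dSeq_mem_Ioo h n).2).2.2.1

lemma dSeq_sq_eq {d₀ : ℝ} (h : d₀ ∈ Ioo (0 : ℝ) 1) (n : ℕ) :
    dSeq d₀ n ^ 2 = 4 * dSeq d₀ (n + 1) / (1 + dSeq d₀ (n + 1)) ^ 2 :=
  (dSeq_succ_spec (dSeq_mem_Ioo h n).1 (dSeq_mem_Ioo h n).2).2.2.2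

/-- The moduli tend to `0` fast enough to beat the growth of the multipliers `2 ^ n`. -/
lemma tendsto_two_pow_mul_dSeq_sq {d₀ : ℝ} (h : d₀ ∈ Ioo (0 : ℝ) 1) :
    Tendsto (fun n => 2 ^ n * dSeq d₀ n ^ 2) atTop (𝓝 0) := by
  have hle : ∀ n, dSeq d₀ n ≤ d₀ ^ (2 ^ n) := by
    intro n
    induction n with
    | zero => simp [dSeq]
    | succ n ih =>
      refine (dSeq_succ_le_sq h n).trans ?_
      rw [pow_succ 2 n, pow_mul]
      exact pow_le_pow_left₀ (dSeq_mem_Ioo h n).1.le ih 2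
  have hlim : Tendsto (fun n : ℕ => ((2 ^ n : ℕ) : ℝ) * d₀ ^ (2 ^ n)) atTop (𝓝 0) := by
    have := tendsto_self_mul_const_pow_of_lt_one h.1.le h.2
    exact this.comp (tendsto_pow_atTop_atTop_of_one_lt one_lt_two)
  refine squeeze_zero (fun n => by positivity) (fun n => ?_) hlim
  have hn := dSeq_mem_Ioo h n
  push_cast
  gcongr
  exact (pow_le_of_le_one hn.1.le hn.2.le two_ne_zero).trans (hle n)

lemma tendsto_dSeq_sq {d₀ : ℝ} (h : d₀ ∈ Ioo (0 : ℝ) 1) :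
    Tendsto (fun n => dSeq d₀ n ^ 2) atTop (𝓝 0) := by
  refine squeeze_zero (fun n => by positivity) (fun n => ?_) (tendsto_two_pow_mul_dSeq_sq h)
  exact le_mul_of_one_le_left (by positivity) (one_le_pow₀ one_le_two)

/-! ### The quadratic iteration and its invariant -/

/-- The product of series attached to `(d_n, a_n, b_n)`, in terms of `ellF` and `ellF'`, does not
depend on `n`. -/
lemma ellF_mul_invariant {d₀ a₀ b₀ : ℝ} (h : d₀ ∈ Ioo (0 : ℝ) 1) (n : ℕ) :
    ellF (dSeq d₀ n ^ 2) * (aSeq d₀ a₀ b₀ n * ellF (dSeq d₀ n ^ 2)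
      + bSeq d₀ b₀ n * (dSeq d₀ n ^ 2 * ellF' (dSeq d₀ n ^ 2))) =
    ellF (d₀ ^ 2) * (a₀ * ellF (d₀ ^ 2) + b₀ * (d₀ ^ 2 * ellF' (d₀ ^ 2))) := by
  induction n with
  | zero => simp [dSeq, aSeq, bSeq]
  | succ n ih =>
    rw [← ih]
    obtain ⟨h0, h1⟩ := dSeq_mem_Ioo h (n + 1)
    have hF := ellF_landen h0 h1
    have hF' := ellF'_landen h0 h1
    rw [← dSeq_sq_eq h n] at hF hF'
    have hx := dSeq_sq_eq h n
    simp only [aSeq, bSeq]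
    rw [hF]
    set y := dSeq d₀ (n + 1)
    set G := ellF (y ^ 2)
    set G' := ellF' (y ^ 2)
    have hy : 1 - y ≠ 0 := by linarith
    have hy' : 1 + y ≠ 0 := by linarith
    have hx' : dSeq d₀ n ^ 2 * ellF' (dSeq d₀ n ^ 2) =
        y * (1 + y) / (1 - y) * (G + 2 * y * (1 + y) * G') := by
      rw [← hF', hx]
      field_simp
    rw [hx']
    field_simp
    ring

lemma bSeq_eq {d₀ b₀ c₀ : ℝ} (h : d₀ ∈ Ioo (0 : ℝ) 1) (hb : b₀ = c₀ * (1 - d₀ ^ 2)) (n : ℕ) :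
    bSeq d₀ b₀ n = c₀ * 2 ^ n * (1 - dSeq d₀ n ^ 2) := by
  induction n with
  | zero => simp [bSeq, dSeq, hb]
  | succ n ih =>
    obtain ⟨h0, h1⟩ := dSeq_mem_Ioo h (n + 1)
    have hx := dSeq_sq_eq h n
    have hy : 1 - dSeq d₀ (n + 1) ≠ 0 := by linarith
    rw [bSeq, ih, hx]
    field_simp
    ring

/-- Since the `ellF (d_n²)` tend to `1` and the `b_n d_n²` to `0`, the invariant of the iteration is
the limit of the `a_n`. -/
lemma tendsto_aSeq {d₀ a₀ b₀ : ℝ} (h : d₀ ∈ Ioo (0 : ℝ) 1) :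
    Tendsto (aSeq d₀ a₀ b₀) atTop
      (𝓝 (ellF (d₀ ^ 2) * (a₀ * ellF (d₀ ^ 2) + b₀ * (d₀ ^ 2 * ellF' (d₀ ^ 2))))) := by
  set A := ellF (d₀ ^ 2) * (a₀ * ellF (d₀ ^ 2) + b₀ * (d₀ ^ 2 * ellF' (d₀ ^ 2))) with hA
  have hF : Tendsto (fun n => ellF (dSeq d₀ n ^ 2)) atTop (𝓝 1) := by
    have := (hasDerivAt_ellF (x := 0) (by simp)).continuousAt.tendsto.comp (tendsto_dSeq_sq h)
    rwa [ellF_zero] at this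
  have hF' : Tendsto (fun n => ellF' (dSeq d₀ n ^ 2)) atTop (𝓝 (ellF' 0)) :=
    (continuousAt_ellF' (x := 0) (by simp)).tendsto.comp (tendsto_dSeq_sq h)
  have hb : Tendsto (fun n => bSeq d₀ b₀ n * dSeq d₀ n ^ 2) atTop (𝓝 0) := by
    have hd : d₀ ^ 2 < 1 := pow_lt_one₀ h.1.le h.2 two_ne_zero
    have hc : b₀ = b₀ / (1 - d₀ ^ 2) * (1 - d₀ ^ 2) := by
      rw [div_mul_cancel₀]
      linarith
    have := ((tendsto_two_pow_mul_dSeq_sq h).const_mul (b₀ / (1 - d₀ ^ 2))).mul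
      ((tendsto_dSeq_sq h).const_sub 1)
    rw [mul_zero, zero_mul] at this
    refine this.congr fun n => ?_
    rw [bSeq_eq h hc n]
    ring
  have hlim := ((tendsto_const_nhds (x := A)).div hF one_ne_zero).sub (hb.mul hF')
  have hlim2 := hlim.div hF one_ne_zero
  simp only [div_one, zero_mul, sub_zero] at hlim2
  refine hlim2.congr fun n => ?_
  have hn := dSeq_mem_Ioo h n
  have hpos := ellF_pos (sq_nonneg (dSeq d₀ n)) (pow_lt_one₀ hn.1.le hn.2 two_ne_zero)
  simp only [Pi.div_apply]
  rw [hA, ← ellF_mul_invariant (a₀ := a₀) (b₀ := b₀) h n]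
  field_simp
  ring

lemma aSimpleSeq_eq {d₀ a₀ b₀ c₀ : ℝ} (h : d₀ ∈ Ioo (0 : ℝ) 1) (hb : b₀ = c₀ * (1 - d₀ ^ 2))
    (n : ℕ) : aSimpleSeq d₀ a₀ c₀ n = aSeq d₀ a₀ b₀ n := by
  induction n with
  | zero => rfl
  | succ n ih =>
    obtain ⟨h0, h1⟩ := dSeq_mem_Ioo h (n + 1)
    rw [aSimpleSeq, aSeq, ih, bSeq_eq h hb]
    field_simp
    ring

lemma rSeq_eq {d₀ a₀ c₀ r₀ : ℝ} (h : d₀ ∈ Ioo (0 : ℝ) 1) (hr : r₀ = a₀ + c₀ / 2 * d₀ ^ 2)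
    (n : ℕ) : rSeq d₀ c₀ r₀ n = aSimpleSeq d₀ a₀ c₀ n + c₀ / 2 * (2 ^ n * dSeq d₀ n ^ 2) := by
  induction n with
  | zero => simp [rSeq, aSimpleSeq, dSeq, hr]
  | succ n ih =>
    obtain ⟨h0, h1⟩ := dSeq_mem_Ioo h (n + 1)
    rw [rSeq, ih, aSimpleSeq, dSeq_sq_eq h n]
    field_simp
    ring

/-! ### The quartic iteration -/

/-- Two steps of the modular iteration, in terms of the square roots of the moduli. -/
lemma dSeq_add_two {d₀ s : ℝ} {n : ℕ} (hs : s ∈ Ioo (0 : ℝ) 1) (hd : dSeq d₀ n = s ^ 2) :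
    let s' := (1 - (1 - s ^ 4) ^ (1 / 4 : ℝ)) / (1 + (1 - s ^ 4) ^ (1 / 4 : ℝ))
    s' ∈ Ioo (0 : ℝ) 1 ∧ dSeq d₀ (n + 1) = 2 * s' / (1 + s' ^ 2) ∧ dSeq d₀ (n + 2) = s' ^ 2 := by
  intro s'
  have hw : 0 < 1 - s ^ 4 := sub_pos.mpr (pow_lt_one₀ hs.1.le hs.2 (by norm_num))
  obtain ⟨q, hq, hqw⟩ : ∃ q : ℝ, 0 < q ∧ (1 - s ^ 4) ^ (1 / 4 : ℝ) = q :=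
    ⟨_, Real.rpow_pos_of_pos hw _, rfl⟩
  have hq4 : 1 - s ^ 4 = q ^ 4 := by
    rw [← hqw, ← Real.rpow_mul_natCast hw.le]
    norm_num
  have hq1 : q < 1 := by
    by_contra! hcon
    have := one_le_pow₀ (n := 4) hcon
    have := pow_pos hs.1 4
    linarith
  have hs' : s' = (1 - q) / (1 + q) := by simp only [s', hqw]
  have e1 : √(1 - dSeq d₀ n ^ 2) = q ^ 2 := by
    rw [hd, show 1 - (s ^ 2) ^ 2 = (q ^ 2) ^ 2 by linear_combination hq4]
    exact Real.sqrt_sq (by positivity)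
  have hd1 : dSeq d₀ (n + 1) = (1 - q ^ 2) / (1 + q ^ 2) := by rw [dSeq, e1]
  have e2 : √(1 - dSeq d₀ (n + 1) ^ 2) = 2 * q / (1 + q ^ 2) := by
    rw [hd1, show 1 - ((1 - q ^ 2) / (1 + q ^ 2)) ^ 2 = (2 * q / (1 + q ^ 2)) ^ 2 by
      field_simp; ring]
    exact Real.sqrt_sq (by positivity)
  have hd2 : dSeq d₀ (n + 2) = ((1 - q) / (1 + q)) ^ 2 := by
    rw [dSeq, e2]
    have : 1 + q ^ 2 + 2 * q ≠ 0 := by positivity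
    field_simp
    ring
  refine ⟨?_, ?_, by rw [hd2, hs']⟩
  · rw [hs']
    refine ⟨div_pos (by linarith) (by linarith), ?_⟩
    rw [div_lt_one (by linarith)]
    linarith
  · rw [hd1, hs']
    have : (1 + q) ^ 2 + (1 - q) ^ 2 ≠ 0 := by positivity
    field_simp
    ring

/-- One quartic step is two quadratic steps. -/
lemma sSeq_tSeq_eq {s₀ c₀ r₀ : ℝ} (h : s₀ ∈ Ioo (0 : ℝ) 1) (n : ℕ) :
    sSeq s₀ n ∈ Ioo (0 : ℝ) 1 ∧ dSeq (s₀ ^ 2) (2 * n) = sSeq s₀ n ^ 2 ∧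
      tSeq s₀ c₀ r₀ n = rSeq (s₀ ^ 2) c₀ r₀ (2 * n) := by
  induction n with
  | zero => exact ⟨h, rfl, rfl⟩
  | succ n ih =>
    obtain ⟨hs, hd, ht⟩ := ih
    obtain ⟨hs', hd1, hd2⟩ := dSeq_add_two hs hd
    change sSeq s₀ (n + 1) ∈ _ at hs'
    change _ = 2 * sSeq s₀ (n + 1) / (1 + sSeq s₀ (n + 1) ^ 2) at hd1
    change _ = sSeq s₀ (n + 1) ^ 2 at hd2
    refine ⟨hs', hd2, ?_⟩
    rw [tSeq, ht, show 2 * (n + 1) = 2 * n + 1 + 1 by ring, rSeq, rSeq, hd1, hd2]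
    field_simp
    ring

/-! ### The value at `d = 1 / √2` -/

lemma one_div_sqrt_two_sq : (1 / √2 : ℝ) ^ 2 = 1 / 2 := by
  rw [div_pow, Real.sq_sqrt (by norm_num), one_pow]

lemma one_div_sqrt_two_mem : (1 / √2 : ℝ) ∈ Ioo (0 : ℝ) 1 := by
  refine ⟨by positivity, ?_⟩
  rw [div_lt_one (by positivity)]
  exact Real.lt_sqrt_of_sq_lt (by norm_num)

lemma hasSum_coeff_half : HasSum (fun k : ℕ => coeff k * (1 / 2 ^ k)) (ellF (1 / 2)) := by
  refine (summable_mul_pow_of_le abs_coeff_le (x := 1 / 2) (by norm_num [abs_of_pos])).hasSum.congr_fun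
    fun k => ?_
  rw [div_pow, one_pow]

lemma hasSum_coeff_mul_half :
    HasSum (fun k : ℕ => coeff k * ((k : ℝ) / 2 ^ k)) (1 / 2 * ellF' (1 / 2)) := by
  rw [← hasSum_nat_add_iff' 1]
  simp only [Finset.sum_range_one, Nat.cast_zero, zero_div, mul_zero, sub_zero]
  refine ((summable_mul_pow_of_le abs_succ_mul_coeff_succ_le (x := 1 / 2)
    (by norm_num [abs_of_pos])).hasSum.mul_left (1 / 2)).congr_fun fun k => ?_
  push_cast
  rw [div_pow, one_pow]
  field_simp
  ring

/-- At the self-complementary point `x = 1 / 2` both terms of Legendre's relation agree. -/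
lemma ellF_half_mul : ellF (1 / 2) * (1 / 2 * ellF' (1 / 2)) = 1 / Real.pi := by
  rw [← ellF_mul_ellP_add (x := 1 / 2) (by norm_num) (by norm_num), ellP, ellP]
  norm_num
  ring

end BorweinPi

theorem mainTheorem5 :
    -- the identity, both series being convergent
    (Summable (fun k : ℕ => BorweinPi.coeff k * (1 / 2 ^ k)) ∧
      Summable (fun k : ℕ => BorweinPi.coeff k * ((k : ℝ) / 2 ^ k)) ∧
      (∑' k : ℕ, BorweinPi.coeff k * (1 / 2 ^ k)) *
        (∑' k : ℕ, BorweinPi.coeff k * ((k : ℝ) / 2 ^ k)) = 1 / Real.pi) ∧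
    -- it is the product of series at the initial values `d₀ = 1/√2`, `a₀ = 0`, `b₀ = 1`,
    -- to which correspond `c₀ = 2`, `r₀ = 1/2`
    (BorweinPi.seriesProduct (1 / √2) 0 1 =
        (∑' k : ℕ, BorweinPi.coeff k * (1 / 2 ^ k)) *
          (∑' k : ℕ, BorweinPi.coeff k * ((k : ℝ) / 2 ^ k)) ∧
      BorweinPi.initC (1 / √2) 1 = 2 ∧
      BorweinPi.initR (1 / √2) 0 2 = 1 / 2) ∧
    -- from these initial values the four iterations tend to `1/π`
    Filter.Tendsto (BorweinPi.aSeq (1 / √2) 0 1) Filter.atTop (nhds (1 / Real.pi)) ∧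
    Filter.Tendsto (BorweinPi.aSimpleSeq (1 / √2) 0 2) Filter.atTop (nhds (1 / Real.pi)) ∧
    Filter.Tendsto (BorweinPi.rSeq (1 / √2) 2 (1 / 2)) Filter.atTop (nhds (1 / Real.pi)) ∧
    Filter.Tendsto (BorweinPi.tSeq √(1 / √2) 2 (1 / 2)) Filter.atTop (nhds (1 / Real.pi)) := by
  open BorweinPi in
  have hd := one_div_sqrt_two_mem
  have hd2 := one_div_sqrt_two_sq
  have ha : Tendsto (aSeq (1 / √2) 0 1) atTop (𝓝 (1 / Real.pi)) := by
    have := tendsto_aSeq (a₀ := 0) (b₀ := 1) hd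
    rwa [hd2, zero_mul, zero_add, one_mul, ellF_half_mul] at this
  have ha' : Tendsto (aSimpleSeq (1 / √2) 0 2) atTop (𝓝 (1 / Real.pi)) :=
    ha.congr fun n => (aSimpleSeq_eq hd (by rw [hd2]; norm_num) n).symm
  have hr : Tendsto (rSeq (1 / √2) 2 (1 / 2)) atTop (𝓝 (1 / Real.pi)) := by
    have := ha'.add ((tendsto_two_pow_mul_dSeq_sq hd).const_mul (2 / 2))
    rw [mul_zero, add_zero] at this
    exact this.congr fun n => (rSeq_eq hd (by rw [hd2]; norm_num) n).symm
  refine ⟨⟨hasSum_coeff_half.summable, hasSum_coeff_mul_half.summable, ?_⟩, ⟨?_, ?_, ?_⟩,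
    ha, ha', hr, ?_⟩
  · rw [hasSum_coeff_half.tsum_eq, hasSum_coeff_mul_half.tsum_eq, ellF_half_mul]
  · simp only [seriesProduct, pow_mul, hd2, div_pow, one_pow, zero_add, one_mul]
    congr 1
    exact tsum_congr fun k => by ring
  · rw [initC, hd2]
    norm_num
  · rw [initR, hd2]
    norm_num
  · have hs : √(1 / √2) ∈ Ioo (0 : ℝ) 1 :=
      ⟨Real.sqrt_pos.mpr hd.1, (Real.sqrt_lt' one_pos).mpr (by rw [one_pow]; exact hd.2)⟩
    have h2 : Tendsto (fun n : ℕ => 2 * n) atTop atTop :=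
      tendsto_id.const_mul_atTop' two_pos
    refine (hr.comp h2).congr fun n => ?_
    rw [(sSeq_tSeq_eq hs n).2.2, Real.sq_sqrt hd.1.le]
    rfl
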